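/- Let $\mathbb{D}=\mathbb{Z}[1/2]\subseteq\mathbb{R}$ be the ring of dyadic rationals, and let $m,n\ge 0$ be integers. Let $P\subseteq\mathbb{D}^m$ be an $n$-dimensional dyadic polytope, that is, $P=C\cap\mathbb{D}^m$, where $C\subseteq\mathbb{R}^m$ is an $n$-dimensional real polytope (the convex hull of a nonempty finite set of points, whose affine hull has dimension $n$) all of whose vertices lie in $\mathbb{D}^m$. Then $P$ is finitely generated as a groupoid under the arithmetic mean $x\circ y=\tfrac12(x+y)$: the set $P$ is closed under $\circ$, and there is a finite set $X\subseteq P$ such that $P$ is the smallest subset of $\mathbb{R}^m$ that contains $X$ and is closed under $\circ$. In particular (the case $m=n$) this holds for the intersection with $\mathbb{D}^n$ of every full-dimensional real polytope in $\mathbb{R}^n$ with vertices in $\mathbb{D}^n$. -/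

import Mathlib

/-- A real number is dyadic if it is a rational number whose denominator is a power of `2`. -/
def IsDyadic (x : ℝ) : Prop :=
  ∃ (a : ℤ) (k : ℕ), x = (a : ℝ) / 2 ^ k

/-- The dyadic space `𝔻ᵐ`, as a subset of `ℝᵐ`. -/
def dyadicSpace (m : ℕ) : Set (Fin m → ℝ) :=
  {x | ∀ i, IsDyadic (x i)}

/-- The arithmetic mean `x ∘ y = (x + y) / 2`. -/
noncomputable def arithMean {m : ℕ} (x y : Fin m → ℝ) : Fin m → ℝ :=
  (1 / 2 : ℝ) • (x + y)

/-- A subset closed under the arithmetic mean, i.e. a subgroupoid for the operation `∘`. -/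
def IsSubgroupoid {m : ℕ} (B : Set (Fin m → ℝ)) : Prop :=
  ∀ x ∈ B, ∀ y ∈ B, arithMean x y ∈ B

/-- The subgroupoid generated by `X`: the intersection of all subgroupoids containing `X`. -/
def generatedSubgroupoid {m : ℕ} (X : Set (Fin m → ℝ)) : Set (Fin m → ℝ) :=
  ⋂₀ {B | IsSubgroupoid B ∧ X ⊆ B}

/-- `P` is a groupoid under `∘` that is generated by finitely many of its elements. -/
def IsFinitelyGeneratedGroupoid {m : ℕ} (P : Set (Fin m → ℝ)) : Prop :=
  IsSubgroupoid P ∧ ∃ X : Set (Fin m → ℝ), X.Finite ∧ X ⊆ P ∧ generatedSubgroupoid X = P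

/-- A real polytope: the convex hull of a nonempty finite set of points. -/
def IsRealPolytope {m : ℕ} (C : Set (Fin m → ℝ)) : Prop :=
  ∃ V : Set (Fin m → ℝ), V.Finite ∧ V.Nonempty ∧ C = convexHull ℝ V

/-- The dimension of a nonempty subset of `ℝᵐ`: the dimension of its real affine hull. -/
noncomputable def affineDim {m : ℕ} (C : Set (Fin m → ℝ)) : ℕ :=
  Module.finrank ℝ (affineSpan ℝ C).direction

/-- An `n`-dimensional dyadic polytope in `𝔻ᵐ`: the set of dyadic points of an `n`-dimensional
real polytope all of whose vertices (extreme points) are dyadic. -/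
def IsDyadicPolytope (n : ℕ) {m : ℕ} (P : Set (Fin m → ℝ)) : Prop :=
  ∃ C : Set (Fin m → ℝ), IsRealPolytope C ∧ affineDim C = n ∧
    C.extremePoints ℝ ⊆ dyadicSpace m ∧ P = C ∩ dyadicSpace m

/-! The dyadic points of `C` are the increasing union of the finite sets `C ∩ 2⁻ʲℤᵐ`. Once `2 ^ j`
is at least the number of vertices, each point at the next finer level is a mean of two points of
`C` one level coarser (`exists_arithMean_eq`). Hence a single level, fine enough, generates all the
others by induction. -/

/-- The lattice `2⁻ʲ ℤᵐ`, as a subset of `ℝᵐ`. -/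
def dyadicLattice (m j : ℕ) : Set (Fin m → ℝ) :=
  {x | ∃ z : Fin m → ℤ, ∀ i, 2 ^ j * x i = z i}

theorem dyadicLattice_mono (m : ℕ) : Monotone (dyadicLattice m) := by
  rintro j k hjk x ⟨z, hz⟩
  obtain ⟨d, rfl⟩ := Nat.exists_eq_add_of_le hjk
  refine ⟨fun i => 2 ^ d * z i, fun i => ?_⟩
  push_cast
  rw [← hz i]
  ring

theorem dyadicLattice_subset_dyadicSpace (m j : ℕ) : dyadicLattice m j ⊆ dyadicSpace m := by
  rintro x ⟨z, hz⟩ i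
  refine ⟨z i, j, ?_⟩
  rw [← hz i]
  field_simp

theorem exists_mem_dyadicLattice {m : ℕ} {x : Fin m → ℝ} (hx : x ∈ dyadicSpace m) :
    ∃ j, x ∈ dyadicLattice m j := by
  choose a k h using hx
  refine ⟨Finset.univ.sup k, fun i => 2 ^ (Finset.univ.sup k - k i) * a i, fun i => ?_⟩
  obtain ⟨d, hd⟩ := Nat.exists_eq_add_of_le (Finset.le_sup (f := k) (Finset.mem_univ i))
  simp only [h i, hd, Nat.add_sub_cancel_left]
  push_cast
  field_simp
  ring

theorem exists_subset_dyadicLattice {m : ℕ} (V : Finset (Fin m → ℝ))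
    (hV : (V : Set (Fin m → ℝ)) ⊆ dyadicSpace m) :
    ∃ j, (V : Set (Fin m → ℝ)) ⊆ dyadicLattice m j := by
  have h : ∀ v : V, ∃ j, (v : Fin m → ℝ) ∈ dyadicLattice m j :=
    fun v => exists_mem_dyadicLattice (hV v.2)
  choose k hk using h
  exact ⟨Finset.univ.sup k, fun v hv =>
    dyadicLattice_mono m (Finset.le_sup (f := k) (Finset.mem_univ ⟨v, hv⟩)) (hk ⟨v, hv⟩)⟩

theorem finite_inter_dyadicLattice {m : ℕ} {C : Set (Fin m → ℝ)} (hC : Bornology.IsBounded C)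
    (j : ℕ) : (C ∩ dyadicLattice m j).Finite := by
  obtain ⟨R, hR⟩ := hC.exists_norm_le
  have hfin : (Set.univ.pi fun _ : Fin m => Set.Icc (-⌈2 ^ j * R⌉) ⌈2 ^ j * R⌉).Finite :=
    Set.Finite.pi fun _ => Set.finite_Icc _ _
  refine (hfin.image fun z i => (z i : ℝ) / 2 ^ j).subset ?_
  rintro x ⟨hx, z, hz⟩
  refine ⟨z, fun i _ => ?_, ?_⟩
  · have h1 : |x i| ≤ R := (norm_le_pi_norm x i).trans (hR x hx)
    have h2 : |(z i : ℝ)| ≤ ⌈2 ^ j * R⌉ := by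
      rw [← hz i, abs_mul, abs_of_pos (by positivity : (0 : ℝ) < 2 ^ j)]
      exact (mul_le_mul_of_nonneg_left h1 (by positivity)).trans (Int.le_ceil _)
    exact abs_le.mp (by exact_mod_cast h2)
  · ext i
    simp only [← hz i]
    field_simp

theorem Finset.exists_le_sum_eq_of_le {ι : Type*} (s : Finset ι) (f : ι → ℕ) {N : ℕ}
    (hN : N ≤ ∑ i ∈ s, f i) : ∃ μ : ι → ℕ, (∀ i ∈ s, μ i ≤ f i) ∧ ∑ i ∈ s, μ i = N := by
  classical
  induction N with
  | zero => exact ⟨0, by simp, by simp⟩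
  | succ N ih =>
    obtain ⟨μ, hle, hsum⟩ := ih (by omega)
    obtain ⟨i, hi, hlt⟩ := Finset.exists_lt_of_sum_lt (s := s) (f := μ) (g := f) (by omega)
    refine ⟨fun k => μ k + if k = i then 1 else 0, fun k hk => ?_, ?_⟩
    · have := hle k hk
      change μ k + (if k = i then 1 else 0) ≤ f k
      split_ifs with h
      · subst h; omega
      · omega
    · simp [Finset.sum_add_distrib, hsum, hi]

/-- Sufficiently large dilates of a lattice polytope have the integer decomposition property
with respect to sums of two points. -/
theorem exists_arithMean_eq {m K j : ℕ} (V : Finset (Fin m → ℝ))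
    (hV : (V : Set (Fin m → ℝ)) ⊆ dyadicLattice m K) (hj : V.card ≤ 2 ^ j) {x : Fin m → ℝ}
    (hx : x ∈ convexHull ℝ (V : Set (Fin m → ℝ))) (hxj : x ∈ dyadicLattice m (K + j + 1)) :
    ∃ a ∈ convexHull ℝ (V : Set (Fin m → ℝ)) ∩ dyadicLattice m (K + j),
      ∃ b ∈ convexHull ℝ (V : Set (Fin m → ℝ)) ∩ dyadicLattice m (K + j), arithMean a b = x := by
  obtain ⟨w, hw0, hw1, hwx⟩ := Finset.mem_convexHull'.mp hx
  -- Rounding down loses at most `1` per vertex, so at least `2 ^ (j + 1) - V.card ≥ 2 ^ j` remains.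
  have hfloor : 2 ^ j ≤ ∑ v ∈ V, ⌊2 ^ (j + 1) * w v⌋₊ := by
    have h1 : ∑ v ∈ V, (2 ^ (j + 1) * w v) ≤ ∑ v ∈ V, ((⌊2 ^ (j + 1) * w v⌋₊ : ℝ) + 1) :=
      Finset.sum_le_sum fun v _ => (Nat.lt_floor_add_one _).le
    rw [← Finset.mul_sum, hw1, Finset.sum_add_distrib, Finset.sum_const, nsmul_eq_mul] at h1
    have h2 : (V.card : ℝ) ≤ 2 ^ j := by exact_mod_cast hj
    have h3 : (2 : ℝ) ^ j ≤ ∑ v ∈ V, (⌊2 ^ (j + 1) * w v⌋₊ : ℝ) := by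
      rw [pow_succ] at h1 ⊢
      linarith
    exact_mod_cast h3
  obtain ⟨μ, hμ, hμsum⟩ := V.exists_le_sum_eq_of_le _ hfloor
  have hμsum' : ∑ v ∈ V, (μ v : ℝ) = 2 ^ j := by exact_mod_cast hμsum
  have hμw : ∀ v ∈ V, (μ v : ℝ) / 2 ^ j ≤ 2 * w v := fun v hv => by
    have h := (Nat.le_floor_iff (mul_nonneg (by positivity) (hw0 v hv))).mp (hμ v hv)
    rw [div_le_iff₀ (by positivity)]
    rw [pow_succ] at h
    linarith
  set a : Fin m → ℝ := ∑ v ∈ V, ((μ v : ℝ) / 2 ^ j) • v with ha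
  have haC : a ∈ convexHull ℝ (V : Set (Fin m → ℝ)) :=
    Finset.mem_convexHull'.mpr ⟨_, fun v _ => by positivity,
      by rw [← Finset.sum_div, hμsum']; field_simp, rfl⟩
  have haj : a ∈ dyadicLattice m (K + j) := by
    have hint : ∀ v ∈ V, ∃ z : Fin m → ℤ, ∀ i, 2 ^ K * v i = z i := fun v hv => hV hv
    choose! z hz using hint
    refine ⟨fun i => ∑ v ∈ V, μ v * z v i, fun i => ?_⟩
    rw [ha, Finset.sum_apply, Finset.mul_sum]
    push_cast
    refine Finset.sum_congr rfl fun v hv => ?_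
    rw [← hz v hv i, Pi.smul_apply, smul_eq_mul, pow_add]
    field_simp
  -- The reflection of `a` in `x` has weights `2 * w v - μ v / 2 ^ j`, nonnegative by `hμw` and of
  -- sum `2 - 1`.
  refine ⟨a, ⟨haC, haj⟩, (2 : ℝ) • x - a, ⟨?_, ?_⟩, ?_⟩
  · refine Finset.mem_convexHull'.mpr ⟨fun v => 2 * w v - (μ v : ℝ) / 2 ^ j,
      fun v hv => sub_nonneg.mpr (hμw v hv), ?_, ?_⟩
    · rw [Finset.sum_sub_distrib, ← Finset.mul_sum, hw1, ← Finset.sum_div, hμsum',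
        div_self (by positivity)]
      norm_num
    · simp only [sub_smul, mul_smul]
      rw [Finset.sum_sub_distrib, ← Finset.smul_sum, hwx]
  · obtain ⟨y, hy⟩ := hxj
    obtain ⟨z, hz⟩ := haj
    refine ⟨y - z, fun i => ?_⟩
    simp only [Pi.sub_apply, Pi.smul_apply, smul_eq_mul]
    push_cast
    rw [← hy, ← hz]
    ring
  · simp [arithMean]

theorem isSubgroupoid_dyadicSpace (m : ℕ) : IsSubgroupoid (dyadicSpace m) := by
  intro x hx y hy
  obtain ⟨j, hj⟩ := exists_mem_dyadicLattice hx
  obtain ⟨k, hk⟩ := exists_mem_dyadicLattice hy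
  obtain ⟨u, hu⟩ := dyadicLattice_mono m (le_max_left j k) hj
  obtain ⟨v, hv⟩ := dyadicLattice_mono m (le_max_right j k) hk
  refine dyadicLattice_subset_dyadicSpace m (max j k + 1) ⟨u + v, fun i => ?_⟩
  simp only [arithMean, Pi.add_apply, Pi.smul_apply, smul_eq_mul]
  push_cast
  rw [← hu, ← hv]
  ring

theorem Convex.isSubgroupoid {m : ℕ} {C : Set (Fin m → ℝ)} (hC : Convex ℝ C) :
    IsSubgroupoid C := by
  intro x hx y hy
  rw [arithMean, smul_add]
  exact hC hx hy (by norm_num) (by norm_num) (by norm_num)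

theorem IsSubgroupoid.inter {m : ℕ} {A B : Set (Fin m → ℝ)} (hA : IsSubgroupoid A)
    (hB : IsSubgroupoid B) : IsSubgroupoid (A ∩ B) :=
  fun x hx y hy => ⟨hA x hx.1 y hy.1, hB x hx.2 y hy.2⟩

/-- By Krein–Milman, the given spanning set, whose points need not be dyadic, can be replaced by the
extreme points. -/
theorem IsRealPolytope.exists_finset_extremePoints {m : ℕ} {C : Set (Fin m → ℝ)}
    (hC : IsRealPolytope C) :
    ∃ V : Finset (Fin m → ℝ), (V : Set (Fin m → ℝ)) = C.extremePoints ℝ ∧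
      C = convexHull ℝ (V : Set (Fin m → ℝ)) := by
  obtain ⟨W, hW, -, rfl⟩ := hC
  have hfin : ((convexHull ℝ W).extremePoints ℝ).Finite :=
    hW.subset extremePoints_convexHull_subset
  refine ⟨hfin.toFinset, hfin.coe_toFinset, ?_⟩
  rw [hfin.coe_toFinset, ← (hfin.isCompact_convexHull (𝕜 := ℝ)).isClosed.closure_eq]
  exact (closure_convexHull_extremePoints (hW.isCompact_convexHull (𝕜 := ℝ))
    (convex_convexHull ℝ W)).symm

theorem isFinitelyGeneratedGroupoid_convexHull_inter {m : ℕ} (V : Finset (Fin m → ℝ))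
    (hV : (V : Set (Fin m → ℝ)) ⊆ dyadicSpace m) :
    IsFinitelyGeneratedGroupoid (convexHull ℝ (V : Set (Fin m → ℝ)) ∩ dyadicSpace m) := by
  have hP := (convex_convexHull ℝ (V : Set (Fin m → ℝ))).isSubgroupoid.inter
    (isSubgroupoid_dyadicSpace m)
  obtain ⟨K, hK⟩ := exists_subset_dyadicLattice V hV
  -- Any `j` with `V.card ≤ 2 ^ j` would serve as starting level.
  set j := V.card with hj
  have hX : convexHull ℝ (V : Set (Fin m → ℝ)) ∩ dyadicLattice m (K + j) ⊆
      convexHull ℝ (V : Set (Fin m → ℝ)) ∩ dyadicSpace m :=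
    Set.inter_subset_inter_right _ (dyadicLattice_subset_dyadicSpace m _)
  refine ⟨hP, _, finite_inter_dyadicLattice
    (V.finite_toSet.isCompact_convexHull (𝕜 := ℝ)).isBounded (K + j), hX,
    Set.Subset.antisymm (fun x hx => hx _ ⟨hP, hX⟩) ?_⟩
  rintro x ⟨hxC, hxD⟩ B ⟨hB, hXB⟩
  have key : ∀ d, convexHull ℝ (V : Set (Fin m → ℝ)) ∩ dyadicLattice m (K + (j + d)) ⊆ B := by
    intro d
    induction d with
    | zero => exact hXB
    | succ d ih =>
      rintro y ⟨hyC, hyL⟩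
      obtain ⟨a, ha, b, hb, rfl⟩ := exists_arithMean_eq (j := j + d) V hK
        ((Nat.le_add_right _ _).trans Nat.lt_two_pow_self.le) hyC hyL
      exact hB a (ih ha) b (ih hb)
  obtain ⟨l, hl⟩ := exists_mem_dyadicLattice hxD
  exact key l ⟨hxC, dyadicLattice_mono m (by omega) hl⟩

theorem theorem3p5 (m n : ℕ) (P : Set (Fin m → ℝ)) (hP : IsDyadicPolytope n P) :
    IsFinitelyGeneratedGroupoid P := by
  obtain ⟨C, hC, -, hext, rfl⟩ := hP
  obtain ⟨V, hV, rfl⟩ := hC.exists_finset_extremePoints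
  exact isFinitelyGeneratedGroupoid_convexHull_inter V (hV ▸ hext)
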